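/- Let $q\ge 2$, let $[q]=\{0,\dots,q-1\}$, and for a word $w=w_1\cdots w_k\in[q]^k$ define: - the self-overlap set $\mathrm{overlap}(w,w)=\{i\in\{1,\dots,k\}: w_1\cdots w_i=w_{k-i+1}\cdots w_k\}$ and the correlation polynomial $\phi_w(t)=\sum_{i\in\mathrm{overlap}(w,w)}t^{i-1}$; - $\mathcal B_n(w)$, the set of words of length $n$ over $[q]$ that do not contain $w$ as a contiguous subword; - $X_{\{w\}}\subset[q]^{\mathbb Z}$, the shift space of all bi-infinite sequences that do not contain $w$; - its entropy $h(X_{\{w\}})=\lim_{n\to\infty}\frac1n\log|\mathcal B_n(X_{\{w\}})|$, where $\mathcal B_n(X)$ is the set of words of length $n$ that occur in elements of $X$; - its zeta function, the formal power series $\zeta_w(t)=\exp\bigl(\sum_{n\ge1}\frac{p_n(X_{\{w\}})}{n}t^n\bigr)\in\mathbb Q[[t]]$, where $p_n(X)$ is the number of $x\in X$ with $\sigma^n x=x$ for the left shift $\sigma$; - the hitting time $\tau_w=\min\{t\in\{k,k+1,\dots\}: Y_{t-k+1}\cdots Y_t=w\}$ (with $\min\emptyset=\infty$), where $(Y_i)_{i\ge1}$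 is an i.i.d. sequence of uniformly distributed random letters in $[q]$, on any probability space. Let $u,v\in[q]^k$ be two words of the same length $k$. Then the following are equivalent: 1. $\mathrm{overlap}(u,u)=\mathrm{overlap}(v,v)$; 2. $\phi_u(t)=\phi_v(t)$ as polynomials; 3. $\phi_u(q)=\phi_v(q)$; 4. $E\tau_u=E\tau_v$; 5. $\zeta_u(t)=\zeta_v(t)$ as formal power series; 6. $|\mathcal B_n(u)|=|\mathcal B_n(v)|$ for all $n\ge 0$; 7. $|\mathcal B_n(u)|=|\mathcal B_n(v)|$ for all sufficiently large $n$; 8. $h(X_{\{u\}})=h(X_{\{v\}})$. -/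

import Mathlib

open MeasureTheory ProbabilityTheory Filter Topology
open scoped ENNReal

namespace ForbiddenWord

/-! Words of length `k` over the alphabet `[q] = {0, …, q - 1}` are functions `Fin k → Fin q`;
the letter `w_{j+1}` of a word `w = w_1 ⋯ w_k` is `w j`. -/

/-- The self-overlap set of `w`: all `i ∈ {1, …, k}` such that the prefix of `w` of length `i`
equals its suffix of length `i`. The letter in position `a < i` is compared with the one in
position `b = k - i + a`. -/
def overlap {q k : ℕ} (w : Fin k → Fin q) : Finset ℕ :=
  {i ∈ Finset.Icc 1 k | ∀ a b : Fin k, (b : ℕ) + i = k + a → w a = w b}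

/-- The correlation polynomial of `w`, the sum of `t ^ (i - 1)` over the self-overlap set. -/
noncomputable def correlationPoly {q k : ℕ} (w : Fin k → Fin q) : Polynomial ℤ :=
  ∑ i ∈ overlap w, Polynomial.X ^ (i - 1)

/-- The set of words of length `n` that do not contain `w` as a contiguous subword. -/
def avoidingWords {q k : ℕ} (w : Fin k → Fin q) (n : ℕ) : Set (Fin n → Fin q) :=
  {b | ¬ ∃ (i : ℕ) (h : i + k ≤ n), ∀ j : Fin k, b ⟨i + j, by omega⟩ = w j}

/-- The shift space of all bi-infinite sequences over `[q]` that do not contain `w`. -/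
def avoidingShift {q k : ℕ} (w : Fin k → Fin q) : Set (ℤ → Fin q) :=
  {x | ¬ ∃ i : ℤ, ∀ j : Fin k, x (i + ((j : ℕ) : ℤ)) = w j}

/-- The set of words of length `n` that occur in elements of `X`. -/
def languageWords {q : ℕ} (X : Set (ℤ → Fin q)) (n : ℕ) : Set (Fin n → Fin q) :=
  {b | ∃ x ∈ X, ∃ i : ℤ, ∀ j : Fin n, x (i + ((j : ℕ) : ℤ)) = b j}

/-- The entropy of `X`, the limit of `(1 / n) log |B_n(X)|`. -/
noncomputable def entropy {q : ℕ} (X : Set (ℤ → Fin q)) : ℝ :=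
  limUnder atTop fun n : ℕ => Real.log (languageWords X n).ncard / n

/-- The left shift on bi-infinite sequences. -/
def shiftMap {q : ℕ} (x : ℤ → Fin q) : ℤ → Fin q := fun i => x (i + 1)

/-- The points of `X` with period `n` (not necessarily their least period). -/
def periodicPoints {q : ℕ} (X : Set (ℤ → Fin q)) (n : ℕ) : Set (ℤ → Fin q) :=
  {x ∈ X | Function.IsPeriodicPt shiftMap n x}

/-- The series `∑_{n ≥ 1} (p_n(X) / n) t ^ n`, where `p_n(X)` is the number of points of `X`
with period `n`. -/
noncomputable def periodicSeries {q : ℕ} (X : Set (ℤ → Fin q)) : PowerSeries ℚ :=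
  PowerSeries.mk fun n => if n = 0 then 0 else ((periodicPoints X n).ncard : ℚ) / n

/-- The zeta function `exp (∑_{n ≥ 1} (p_n(X) / n) t ^ n)` of `X`, as a formal power series. -/
noncomputable def zeta {q : ℕ} (X : Set (ℤ → Fin q)) : PowerSeries ℚ :=
  (PowerSeries.exp ℚ).subst (periodicSeries X)

/-- The hitting time of `w` by a sequence of letters whose `(m + 1)`-st term is `y m`: the least
`t` such that the letters number `t - k + 1, …, t` spell `w`, and `∞` if there is none. -/
noncomputable def hittingTime {q k : ℕ} (w : Fin k → Fin q) (y : ℕ → Fin q) : ℕ∞ :=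
  sInf {t | ∃ n : ℕ, (∀ j : Fin k, y (n + j) = w j) ∧ t = ((n + k : ℕ) : ℕ∞)}

/-- The expected hitting time of `w` by a random sequence of letters, a value in `[0, ∞]`. -/
noncomputable def expectedHittingTime {q k : ℕ} (w : Fin k → Fin q)
    {Ω : Type*} [MeasurableSpace Ω] (μ : Measure Ω) (Y : ℕ → Ω → Fin q) : ℝ≥0∞ :=
  ∫⁻ ω, (hittingTime w (fun m => Y m ω) : ℝ≥0∞) ∂μ

/-! The definitions by a limit, a cardinality and a substitution take no default value. -/

theorem ncard_languageWords_add_le {q : ℕ} (X : Set (ℤ → Fin q)) (m n : ℕ) :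
    (languageWords X (m + n)).ncard ≤ (languageWords X m).ncard * (languageWords X n).ncard := by
  rw [← Set.ncard_prod]
  refine Set.ncard_le_ncard_of_injOn
    (fun b => (fun j => b (Fin.castAdd n j), fun j => b (Fin.natAdd m j))) ?_ ?_ (Set.toFinite _)
  · rintro b ⟨x, hx, i, hi⟩
    refine ⟨⟨x, hx, i, fun j => ?_⟩, ⟨x, hx, i + m, fun j => ?_⟩⟩
    · simpa using hi (Fin.castAdd n j)
    · have := hi (Fin.natAdd m j)
      simpa [add_assoc] using this
  · intro b _ c _ h
    simp only [Prod.mk.injEq] at h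
    funext j
    refine Fin.addCases (fun j => ?_) (fun j => ?_) j
    · exact congrFun h.1 j
    · exact congrFun h.2 j

/-- The limit that defines the entropy exists. -/
theorem tendsto_entropy {q : ℕ} (X : Set (ℤ → Fin q)) :
    Tendsto (fun n : ℕ => Real.log (languageWords X n).ncard / n) atTop (𝓝 (entropy X)) := by
  have hsub : Subadditive fun n : ℕ => Real.log (languageWords X n).ncard := by
    intro m n
    have h := ncard_languageWords_add_le X m n
    rcases Nat.eq_zero_or_pos (languageWords X (m + n)).ncard with h0 | h0
    · simp only [h0, Nat.cast_zero, Real.log_zero]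
      exact add_nonneg (Real.log_natCast_nonneg _) (Real.log_natCast_nonneg _)
    · have hp := h0.trans_le h
      have hm := Nat.pos_of_mul_pos_right hp
      have hn := Nat.pos_of_mul_pos_left hp
      rw [← Real.log_mul (by positivity) (by positivity)]
      exact Real.log_le_log (by exact_mod_cast h0) (by exact_mod_cast h)
  refine tendsto_nhds_limUnder ⟨_, hsub.tendsto_lim ⟨0, ?_⟩⟩
  rintro _ ⟨n, rfl⟩
  exact div_nonneg (Real.log_natCast_nonneg _) (Nat.cast_nonneg n)

theorem finite_periodicPoints {q : ℕ} (X : Set (ℤ → Fin q)) {n : ℕ} (hn : 0 < n) :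
    (periodicPoints X n).Finite := by
  have key : ∀ (m : ℕ) (x : ℤ → Fin q) (i : ℤ), shiftMap^[m] x i = x (i + m) := by
    intro m
    induction m with
    | zero => simp
    | succ m ih =>
      intro x i
      rw [Function.iterate_succ_apply, ih]
      simp [shiftMap, add_assoc]
  refine Set.Finite.of_finite_image (f := fun x (j : Fin n) => x ((j : ℕ) : ℤ))
    (Set.toFinite _) ?_
  have per : ∀ x ∈ periodicPoints X n, Function.Periodic x (n : ℤ) := by
    intro x hx i
    rw [← key n x i]
    exact congrFun hx.2 i
  intro x hx y hy h
  funext i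
  have hpos : (0 : ℤ) < n := by exact_mod_cast hn
  have hmod : ∀ z ∈ periodicPoints X n, z i = z (i % n) := by
    intro z hz
    have := (per z hz).sub_zsmul_eq (x := i) (i / n)
    rw [← this]
    congr 1
    rw [Int.emod_def, smul_eq_mul, mul_comm]
  rw [hmod x hx, hmod y hy]
  have h0 := Int.emod_nonneg i hpos.ne'
  have h1 := Int.emod_lt_of_pos i hpos
  have h2 := congrFun h ⟨(i % n).toNat, by omega⟩
  simpa [Int.toNat_of_nonneg h0] using h2

theorem hasSubst_periodicSeries {q : ℕ} (X : Set (ℤ → Fin q)) :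
    PowerSeries.HasSubst (periodicSeries X) := by
  apply PowerSeries.HasSubst.of_constantCoeff_zero'
  rw [← PowerSeries.coeff_zero_eq_constantCoeff_apply]
  simp [periodicSeries]

end ForbiddenWord

/-!
Let `a n` be the number of words of length `n` that avoid `w`, and `e n` the number of words of
length `n` in which `w` occurs at the end and nowhere else. Appending one letter to an avoiding word
gives `q * a n = a (n + 1) + e (n + 1)` (`mul_ncard_avoiding`), and appending the whole word `w`
gives `a n = ∑ i ∈ overlap w, e (n + i)` (`ncard_avoiding_eq_sum`). These two identities determine
`a` from the self-overlap set, and they give the generating function `S(x) = ∑ a n / x ^ n`: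
`S(x) * (1 + (x - q) * φ(x)) = x * φ(x)` wherever the series converges (`tsum_avoiding_mul`), where
`φ` is the correlation polynomial.

* At `x = q` the series is the sum of the tail probabilities of the hitting time, so the expected
  hitting time is `q * φ(q)` (`expectedHittingTime_eq`). As the coefficients of `φ` are `0` and `1`,
  they are the base `q` digits of `φ(q)`.
* The words of the shift space are exactly the avoiding words, so `a n` grows like `λ ^ n` where
  `λ` is the exponential of the entropy. The series diverges at `λ`, which makes `λ` a root of
  `1 + (x - q) * φ(x)` (`entropy_root`). If two words have the same `λ`, then their correlation
  polynomials agree at `λ`. A `0`-`1` polynomial that differs from another one has, at `x ≥ 2`,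
  a highest differing power that outweighs all lower ones. For `q = 2` the number `λ` is below `2`,
  but `(q - λ) * φ(λ) = 1` says that either `λ = 1` and `φ` is a single power, or `λ` is close
  enough to `2` for the same conclusion (`false_of_sum_pow_eq`).
* For the zeta function, let `N n` be the number of words of length `n + k` that begin and end with
  `w`, and `R n` the number of points with period `n` that contain `w`. Marking a position in
  a word counted by `N n` and cutting the word at the next occurrence of `w` gives
  `n * N n = ∑ m ∈ Icc 1 n, R m * N (n - m)` (`mul_ncard_bordered`). As `N 0 = 1`, the sequences
  `N` and `R` determine each other; and `N n` for `n < k` tells whether `k - n` is a self-overlap,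
  while for `n ≥ k` it is the number of all words of length `n - k`. The zeta function determines
  the numbers of periodic points because `exp` is injective on power series without constant term.
-/

namespace ForbiddenWord

/-! ### Finite words as sequences, and occurrences -/

/-- The words of length `n`, encoded as the sequences that vanish from the position `n` on. This
encoding makes truncation and concatenation free of casts between the types `Fin n → Fin q`. -/
def words (q n : ℕ) [NeZero q] : Set (ℕ → Fin q) := {y | ∀ i, n ≤ i → y i = 0}

/-- The word `w` occurs in the sequence `y` at the position `i`. -/
def OccursAt {q k : ℕ} (w : Fin k → Fin q) (y : ℕ → Fin q) (i : ℕ) : Prop :=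
  ∀ (j : ℕ) (hj : j < k), y (i + j) = w ⟨j, hj⟩

/-- The first `n` letters of `y`, followed by the sequence `z`. -/
def glue {q : ℕ} (n : ℕ) (y z : ℕ → Fin q) : ℕ → Fin q := fun i => if i < n then y i else z (i - n)

/-- The word formed by the first `n` letters of `y`. -/
def truncate {q : ℕ} [NeZero q] (n : ℕ) (y : ℕ → Fin q) : ℕ → Fin q :=
  fun i => if i < n then y i else 0

/-- The word `w`, encoded as a sequence. -/
def toSeq {q k : ℕ} [NeZero q] (w : Fin k → Fin q) : ℕ → Fin q :=
  fun i => if h : i < k then w ⟨i, h⟩ else 0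

/-- The words of length `n` without an occurrence of `w`. -/
def avoiding {q k : ℕ} [NeZero q] (w : Fin k → Fin q) (n : ℕ) : Set (ℕ → Fin q) :=
  {y ∈ words q n | ∀ i, i + k ≤ n → ¬ OccursAt w y i}

/-- The words of length `n` in which `w` occurs at the end and nowhere else. -/
def firstAtEnd {q k : ℕ} [NeZero q] (w : Fin k → Fin q) (n : ℕ) : Set (ℕ → Fin q) :=
  {y ∈ words q n | ∃ p, p + k = n ∧ OccursAt w y p ∧ ∀ i < p, ¬ OccursAt w y i}

section Words

variable {q k : ℕ} (w : Fin k → Fin q)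

theorem OccursAt.congr {w : Fin k → Fin q} {y z : ℕ → Fin q} {i i' : ℕ}
    (h : ∀ j < k, z (i' + j) = y (i + j)) (hy : OccursAt w y i) : OccursAt w z i' :=
  fun j hj => (h j hj).trans (hy j hj)

theorem occursAt_congr {w : Fin k → Fin q} {y z : ℕ → Fin q} {i i' : ℕ}
    (h : ∀ j < k, z (i' + j) = y (i + j)) : OccursAt w z i' ↔ OccursAt w y i :=
  ⟨OccursAt.congr fun j hj => (h j hj).symm, OccursAt.congr h⟩

theorem glue_of_lt {n i : ℕ} {y z : ℕ → Fin q} (h : i < n) : glue n y z i = y i := if_pos h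

theorem glue_add {n i : ℕ} {y z : ℕ → Fin q} : glue n y z (n + i) = z i := by simp [glue]

theorem glue_of_le {n i : ℕ} {y z : ℕ → Fin q} (h : n ≤ i) : glue n y z i = z (i - n) :=
  if_neg (by omega)

theorem mem_overlap {i : ℕ} : i ∈ overlap w ↔ (1 ≤ i ∧ i ≤ k) ∧
    ∀ (a b : ℕ) (ha : a < k) (hb : b < k), b + i = k + a → w ⟨a, ha⟩ = w ⟨b, hb⟩ := by
  simp only [overlap, Finset.mem_filter, Finset.mem_Icc]
  exact and_congr_right fun _ => ⟨fun h a b ha hb => h ⟨a, ha⟩ ⟨b, hb⟩, fun h a b => h a b a.2 b.2⟩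

theorem length_mem_overlap (hk : 0 < k) : k ∈ overlap w :=
  (mem_overlap w).2 ⟨⟨hk, le_rfl⟩, fun a b _ _ h => by congr 2; omega⟩

/-- Two occurrences at a distance `d < k` overlap in `k - d` letters. -/
theorem OccursAt.sub_mem_overlap {w : Fin k → Fin q} {y : ℕ → Fin q} {p d : ℕ} (hd : d < k)
    (h : OccursAt w y p) (h' : OccursAt w y (p + d)) : k - d ∈ overlap w := by
  refine (mem_overlap w).2 ⟨⟨by omega, by omega⟩, fun a b ha hb hab => ?_⟩
  rw [← h' a ha, ← h b hb]
  congr 1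
  omega

variable [NeZero q]

theorem truncate_of_lt {n i : ℕ} {y : ℕ → Fin q} (h : i < n) : truncate n y i = y i := if_pos h

theorem truncate_mem_words (n : ℕ) (y : ℕ → Fin q) : truncate n y ∈ words q n :=
  fun _ hi => if_neg (by omega)

theorem toSeq_of_lt {i : ℕ} (h : i < k) : toSeq w i = w ⟨i, h⟩ := dif_pos h

theorem toSeq_mem_words : toSeq w ∈ words q k := fun _ hi => dif_neg (by omega)

theorem glue_mem_words {n m : ℕ} {y z : ℕ → Fin q} (hz : z ∈ words q m) :
    glue n y z ∈ words q (n + m) := fun i hi => by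
  rw [glue_of_le (by omega)]
  exact hz _ (by omega)

theorem words_ext {n : ℕ} {y z : ℕ → Fin q} (hy : y ∈ words q n) (hz : z ∈ words q n)
    (h : ∀ i < n, y i = z i) : y = z := by
  funext i
  by_cases hi : i < n
  · exact h i hi
  · rw [hy i (by omega), hz i (by omega)]

theorem finite_words (n : ℕ) : (words q n).Finite := by
  refine Set.Finite.of_finite_image (f := fun y (j : Fin n) => y j) (Set.toFinite _) ?_
  exact fun y hy z hz h => words_ext hy hz fun i hi => congrFun h ⟨i, hi⟩

theorem finite_avoiding (n : ℕ) : (avoiding w n).Finite := (finite_words n).subset fun _ h => h.1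

theorem finite_firstAtEnd (n : ℕ) : (firstAtEnd w n).Finite :=
  (finite_words n).subset fun _ h => h.1

theorem ncard_avoiding (n : ℕ) : (avoiding w n).ncard = (avoidingWords w n).ncard := by
  refine Set.BijOn.ncard_eq (f := fun y (j : Fin n) => y j) ⟨?_, ?_, ?_⟩
  · rintro y ⟨-, hy⟩ ⟨i, hi, h⟩
    exact hy i hi fun j hj => h ⟨j, hj⟩
  · exact fun y hy z hz h => words_ext hy.1 hz.1 fun i hi => congrFun h ⟨i, hi⟩
  · intro b hb
    refine ⟨toSeq b, ⟨toSeq_mem_words b, fun i hi h => hb ⟨i, hi, fun j => ?_⟩⟩, ?_⟩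
    · rw [← h j j.2, toSeq_of_lt]
    · funext j
      exact toSeq_of_lt b j.2

theorem ncard_avoiding_zero (hk : 0 < k) : (avoiding w 0).ncard = 1 := by
  rw [Set.ncard_eq_one]
  refine ⟨fun _ => 0, Set.eq_singleton_iff_unique_mem.2
    ⟨⟨fun _ _ => rfl, fun i hi => by omega⟩, ?_⟩⟩
  exact fun y hy => funext fun i => hy.1 i (Nat.zero_le i)

theorem firstAtEnd_of_lt {n : ℕ} (hn : n < k) : firstAtEnd w n = ∅ :=
  Set.eq_empty_of_forall_notMem fun _ ⟨_, _, hp, _⟩ => by omega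

end Words

/-! ### The two counting identities -/

/-- A finite set is counted by splitting it along a parameter that each element determines. -/
theorem ncard_eq_sum_ncard {α : Type*} {S : Set α} (hS : S.Finite) (I : Finset ℕ)
    (P : ℕ → α → Prop) (hex : ∀ x ∈ S, ∃ i ∈ I, P i x)
    (huniq : ∀ x ∈ S, ∀ i ∈ I, ∀ j ∈ I, P i x → P j x → i = j) :
    S.ncard = ∑ i ∈ I, {x ∈ S | P i x}.ncard := by
  classical
  have hU : S = ⋃ i ∈ I, {x ∈ S | P i x} := by
    ext x
    simp only [Set.mem_iUnion, Set.mem_ofPred_eq, exists_prop]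
    exact ⟨fun hx => (hex x hx).imp fun i hi => ⟨hi.1, hx, hi.2⟩, fun ⟨_, _, hx, _⟩ => hx⟩
  have hfin : ∀ i, {x ∈ S | P i x}.Finite := fun i => hS.subset fun _ h => h.1
  have h1 : hS.toFinset = I.biUnion fun i => (hfin i).toFinset := by
    ext x
    rw [Set.Finite.mem_toFinset]
    nth_rw 1 [hU]
    simp only [Set.mem_iUnion, Finset.mem_biUnion, Set.Finite.mem_toFinset, exists_prop]
  rw [Set.ncard_eq_toFinset_card S hS, h1, Finset.card_biUnion]
  · exact Finset.sum_congr rfl fun i _ => (Set.ncard_eq_toFinset_card _ (hfin i)).symm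
  · intro i hi j hj hij
    refine Finset.disjoint_left.2 ?_
    intro x hxi hxj
    simp only [Set.Finite.mem_toFinset, Set.mem_ofPred_eq] at hxi hxj
    exact hij (huniq x hxi.1 i hi j hj hxi.2 hxj.2)

section Counting

variable {q k : ℕ} [NeZero q] (w : Fin k → Fin q)

/-- Appending a letter to a word that avoids `w` gives either a word that avoids `w` or a word in
which `w` occurs at the end only. -/
theorem mul_ncard_avoiding (n : ℕ) :
    q * (avoiding w n).ncard = (avoiding w (n + 1)).ncard + (firstAtEnd w (n + 1)).ncard := by
  have hdisj : Disjoint (avoiding w (n + 1)) (firstAtEnd w (n + 1)) := by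
    rw [Set.disjoint_left]
    rintro y ⟨-, hy⟩ ⟨-, p, hp, hp', -⟩
    exact hy p hp.le hp'
  rw [← Set.ncard_union_eq hdisj (finite_avoiding w _) (finite_firstAtEnd w _)]
  have hq : q = (Set.univ : Set (Fin q)).ncard := by simp [Set.ncard_univ]
  nth_rw 1 [hq]
  rw [← Set.ncard_prod]
  have key : ∀ y z : ℕ → Fin q, (∀ i < n, z i = y i) → ∀ i, i + k ≤ n →
      (OccursAt w z i ↔ OccursAt w y i) := fun y z h i hi =>
    occursAt_congr fun j hj => h _ (by omega)
  refine Set.BijOn.ncard_eq (f := fun c => glue n c.2 fun i => if i = 0 then c.1 else 0)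
    ⟨?_, ?_, ?_⟩
  · rintro ⟨c, y⟩ ⟨-, hy, hav⟩
    have hW : glue n y (fun i => if i = 0 then c else 0) ∈ words q (n + 1) :=
      glue_mem_words fun i hi => if_neg (by omega)
    have hno : ∀ i, i + k ≤ n → ¬ OccursAt w (glue n y fun i => if i = 0 then c else 0) i := by
      intro i hi
      rw [key y _ (fun i hi => glue_of_lt hi) i hi]
      exact hav i hi
    by_cases h : ∃ p, p + k = n + 1 ∧ OccursAt w (glue n y fun i => if i = 0 then c else 0) p
    · obtain ⟨p, hp, hp'⟩ := h
      exact Or.inr ⟨hW, p, hp, hp', fun i hi => hno i (by omega)⟩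
    · refine Or.inl ⟨hW, fun i hi hi' => ?_⟩
      rcases Nat.lt_or_ge n (i + k) with h1 | h1
      · exact h ⟨i, by omega, hi'⟩
      · exact hno i h1 hi'
  · rintro ⟨c, y⟩ ⟨-, hy⟩ ⟨d, z⟩ ⟨-, hz⟩ h
    have h1 : c = d := by simpa [glue] using congrFun h n
    have h2 : y = z := words_ext hy.1 hz.1 fun i hi => by
      simpa [glue, hi] using congrFun h i
    rw [h1, h2]
  · intro z hz
    have hzW : z ∈ words q (n + 1) := hz.elim (fun h => h.1) fun h => h.1
    refine ⟨(z n, truncate n z), ⟨trivial, truncate_mem_words n z, fun i hi => ?_⟩, ?_⟩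
    · rw [key z _ (fun i hi => truncate_of_lt hi) i hi]
      rcases hz with ⟨-, hz⟩ | ⟨-, p, hp, -, hz⟩
      · exact hz i (by omega)
      · exact hz i (by omega)
    · refine words_ext (n := n + 1) (glue_mem_words fun i hi => if_neg (by omega)) hzW ?_
      intro i hi
      rcases Nat.lt_or_ge i n with h1 | h1
      · simp [glue, truncate, h1]
      · obtain rfl : i = n := by omega
        simp [glue]

/-- Append `w` to a word that avoids `w`, and cut the result after the first occurrence of `w`:
this occurrence shares some number `i` of letters with the appended `w`, and `i` is a
self-overlap of `w`. -/
theorem ncard_avoiding_eq_sum (n : ℕ) :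
    (avoiding w n).ncard = ∑ i ∈ overlap w, (firstAtEnd w (n + i)).ncard := by
  have hend : ∀ y : ℕ → Fin q, OccursAt w (glue n y (toSeq w)) n := fun y j hj => by
    rw [glue_add, toSeq_of_lt]
  have hkey : ∀ y : ℕ → Fin q, ∀ i, i + k ≤ n →
      (OccursAt w (glue n y (toSeq w)) i ↔ OccursAt w y i) := fun y i hi =>
    occursAt_congr fun j hj => glue_of_lt (by omega)
  rw [ncard_eq_sum_ncard (finite_avoiding w n) (overlap w) fun i y => ∃ p, p + k = n + i ∧
    OccursAt w (glue n y (toSeq w)) p ∧ ∀ p' < p, ¬ OccursAt w (glue n y (toSeq w)) p']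
  · refine Finset.sum_congr rfl fun i hi => ?_
    obtain ⟨⟨hi1, hik⟩, hov⟩ := (mem_overlap w).1 hi
    refine Set.BijOn.ncard_eq (f := fun y => truncate (n + i) (glue n y (toSeq w))) ⟨?_, ?_, ?_⟩
    · rintro y ⟨-, p, hp, hp', hlt⟩
      refine ⟨truncate_mem_words _ _, p, hp, ?_, fun p' h => ?_⟩
      · exact hp'.congr fun j hj => truncate_of_lt (by omega)
      · rw [occursAt_congr fun j hj => truncate_of_lt (by omega)]
        exact hlt p' h
    · rintro y ⟨hy, -⟩ z ⟨hz, -⟩ h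
      refine words_ext hy.1 hz.1 fun j hj => ?_
      have := congrFun h j
      simpa [truncate, glue, hj, show j < n + i by omega] using this
    · rintro z ⟨hz, p, hp, hp', hlt⟩
      have hagree : ∀ j < n + i, glue n (truncate n z) (toSeq w) j = z j := by
        intro j hj
        rcases Nat.lt_or_ge j n with h | h
        · rw [glue_of_lt h, truncate_of_lt h]
        · rw [glue_of_le h, toSeq_of_lt w (by omega),
            hov (j - n) (j - p) (by omega) (by omega) (by omega), ← hp' (j - p) (by omega)]
          congr 1
          omega
      refine ⟨truncate n z,
        ⟨⟨truncate_mem_words n z, fun p' h => ?_⟩, p, hp, ?_, fun p' h => ?_⟩, ?_⟩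
      · rw [occursAt_congr fun j hj => truncate_of_lt (by omega)]
        exact hlt p' (by omega)
      · exact hp'.congr fun j hj => hagree _ (by omega)
      · rw [occursAt_congr fun j hj => hagree _ (by omega)]
        exact hlt p' h
      · refine words_ext (truncate_mem_words _ _) hz fun j hj => ?_
        exact (truncate_of_lt hj).trans (hagree j hj)
  · rintro y ⟨hy, hav⟩
    classical
    have hex : ∃ p, OccursAt w (glue n y (toSeq w)) p := ⟨n, hend y⟩
    have hle : Nat.find hex ≤ n := Nat.find_min' hex (hend y)
    have hgt : n < Nat.find hex + k := by
      by_contra! h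
      exact hav _ h ((hkey y _ h).1 (Nat.find_spec hex))
    refine ⟨Nat.find hex + k - n, ?_, Nat.find hex, by omega, Nat.find_spec hex,
      fun p' h => Nat.find_min hex h⟩
    have := (Nat.find_spec hex).sub_mem_overlap (d := n - Nat.find hex) (by omega)
      (by rw [Nat.add_sub_cancel' hle]; exact hend y)
    rwa [show Nat.find hex + k - n = k - (n - Nat.find hex) by omega]
  · rintro y - i - j - ⟨p, hp, h1, h2⟩ ⟨p', hp', h1', h2'⟩
    have : p = p' := le_antisymm (not_lt.1 fun h => h2 _ h h1') (not_lt.1 fun h => h2' _ h h1)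
    omega

end Counting

/-! ### Periodic points and words that begin and end with `w` -/

/-- The word `w` occurs in the bi-infinite sequence `x` at the position `i`. -/
def OccursAtInt {q k : ℕ} (w : Fin k → Fin q) (x : ℤ → Fin q) (i : ℤ) : Prop :=
  ∀ (j : ℕ) (hj : j < k), x (i + j) = w ⟨j, hj⟩

/-- The words of length `n + k` that begin and end with `w`; the two occurrences may overlap. -/
def bordered {q k : ℕ} [NeZero q] (w : Fin k → Fin q) (n : ℕ) : Set (ℕ → Fin q) :=
  {y ∈ words q (n + k) | OccursAt w y 0 ∧ OccursAt w y n}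

/-- The bi-infinite sequences with period `n` that contain `w`. -/
def periodicContaining {q k : ℕ} (w : Fin k → Fin q) (n : ℕ) : Set (ℤ → Fin q) :=
  {x | Function.IsPeriodicPt shiftMap n x ∧ ∃ i, OccursAtInt w x i}

theorem mem_avoidingShift {q k : ℕ} (w : Fin k → Fin q) (x : ℤ → Fin q) :
    x ∈ avoidingShift w ↔ ∀ i, ¬ OccursAtInt w x i := by
  rw [← not_exists]
  exact not_congr (exists_congr fun i => ⟨fun h j hj => h ⟨j, hj⟩, fun h j => h j j.2⟩)

section Periodic

variable {q k : ℕ} (w : Fin k → Fin q)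

theorem shiftMap_iterate (n : ℕ) (x : ℤ → Fin q) (i : ℤ) : shiftMap^[n] x i = x (i + n) := by
  induction n generalizing x i with
  | zero => simp
  | succ n ih =>
    rw [Function.iterate_succ_apply, ih]
    simp [shiftMap, add_assoc]

theorem isPeriodicPt_shiftMap {n : ℕ} {x : ℤ → Fin q} :
    Function.IsPeriodicPt shiftMap n x ↔ Function.Periodic x (n : ℤ) := by
  refine ⟨fun h i => ?_, fun h => funext fun i => ?_⟩
  · rw [← shiftMap_iterate n x i]
    exact congrFun h i
  · rw [shiftMap_iterate]
    exact h i

theorem occursAtInt_add_mul_iff {w : Fin k → Fin q} {x : ℤ → Fin q} {n : ℤ}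
    (h : Function.Periodic x n) (i m : ℤ) : OccursAtInt w x (i + m * n) ↔ OccursAtInt w x i := by
  refine forall₂_congr fun j hj => ?_
  have := h.int_mul m (i + j)
  rw [Int.cast_id] at this
  rw [add_right_comm, this]

theorem finite_periodicContaining {n : ℕ} (hn : 0 < n) : (periodicContaining w n).Finite :=
  (finite_periodicPoints Set.univ hn).subset fun _ hx => ⟨trivial, hx.1⟩

theorem ncard_periodicPoints_add {n : ℕ} (hn : 0 < n) :
    (periodicPoints (avoidingShift w) n).ncard + (periodicContaining w n).ncard =
      (periodicPoints (Set.univ : Set (ℤ → Fin q)) n).ncard := by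
  rw [← Set.ncard_union_eq _ (finite_periodicPoints _ hn) (finite_periodicContaining w hn)]
  · congr 1
    ext x
    simp only [periodicPoints, periodicContaining, Set.mem_union, Set.mem_ofPred_eq,
      mem_avoidingShift, Set.mem_univ, true_and, ← not_exists]
    tauto
  · rw [Set.disjoint_left]
    rintro x ⟨hx, -⟩ ⟨-, i, hi⟩
    exact (mem_avoidingShift w x).1 hx i hi

/-- A sequence with two occurrences of `w` at the distance `n` has period `n` up to the end of the
second one. -/
theorem OccursAt.eq_mod {w : Fin k → Fin q} {y : ℕ → Fin q} {n : ℕ} (hn : 0 < n)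
    (h0 : OccursAt w y 0) (h : OccursAt w y n) : ∀ i < n + k, y i = y (i % n) := by
  intro i
  induction i using Nat.strong_induction_on with
  | _ i ih =>
    intro hi
    rcases Nat.lt_or_ge i n with hin | hin
    · rw [Nat.mod_eq_of_lt hin]
    · have h1 := h (i - n) (by omega)
      have h2 := h0 (i - n) (by omega)
      rw [Nat.add_sub_cancel' hin] at h1
      rw [Nat.zero_add] at h2
      rw [h1, ← h2, ih (i - n) (by omega) (by omega), Nat.mod_eq_sub_mod hin]

/-- If `y` starts as a shift of `x` does, then the occurrences of `w` correspond. -/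
theorem occursAt_iff_occursAtInt {y : ℕ → Fin q} {x : ℤ → Fin q} {n s : ℕ}
    (h : ∀ i < n + k, y i = x (i - s)) {i : ℕ} (hi : i ≤ n) :
    OccursAt w y i ↔ OccursAtInt w x (i - s) := by
  refine forall₂_congr fun j hj => ?_
  rw [h _ (by omega)]
  push_cast
  rw [show (i : ℤ) + j - s = i - s + j by ring]

theorem ncard_periodicContaining_eq_sum {m : ℕ} (hm : 0 < m) :
    (periodicContaining w m).ncard = ∑ s ∈ Finset.range m,
      {x ∈ periodicContaining w m | OccursAtInt w x (m - s : ℕ) ∧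
        ∀ i : ℕ, 0 < i → i < m - s → ¬ OccursAtInt w x i}.ncard := by
  have hm0 : (0 : ℤ) < m := by omega
  refine ncard_eq_sum_ncard (finite_periodicContaining w hm) _
    (fun s x => OccursAtInt w x (m - s : ℕ) ∧
      ∀ i : ℕ, 0 < i → i < m - s → ¬ OccursAtInt w x i) ?_ ?_
  · rintro x ⟨hper, i, hi⟩
    rw [isPeriodicPt_shiftMap] at hper
    classical
    have hex : ∃ d : ℕ, (0 < d ∧ d ≤ m) ∧ OccursAtInt w x d := by
      have h1 := Int.emod_lt_of_pos (i - 1) hm0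
      have h2 := Int.emod_nonneg (i - 1) hm0.ne'
      refine ⟨((i - 1) % m).toNat + 1, ⟨by omega, by omega⟩, ?_⟩
      rw [← occursAtInt_add_mul_iff hper _ ((i - 1) / m)]
      convert hi using 1
      have := Int.emod_add_mul_ediv (i - 1) m
      push_cast
      rw [Int.toNat_of_nonneg h2]
      linarith
    obtain ⟨⟨h1, h2⟩, h3⟩ := Nat.find_spec hex
    refine ⟨m - Nat.find hex, Finset.mem_range.2 (by omega), ?_⟩
    rw [Nat.sub_sub_self h2]
    exact ⟨h3, fun i hi him hi' => Nat.find_min hex him ⟨⟨hi, by omega⟩, hi'⟩⟩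
  · rintro x - i hi j hj ⟨hi1, hi2⟩ ⟨hj1, hj2⟩
    rw [Finset.mem_range] at hi hj
    have h1 := not_lt.1 fun h => hi2 (m - j) (by omega) h hj1
    have h2 := not_lt.1 fun h => hj2 (m - i) (by omega) h hi1
    omega

variable [NeZero q]

theorem finite_bordered (n : ℕ) : (bordered w n).Finite := (finite_words _).subset fun _ h => h.1

theorem ncard_bordered_of_lt {n : ℕ} (hn : n < k) [Decidable (k - n ∈ overlap w)] :
    (bordered w n).ncard = if k - n ∈ overlap w then 1 else 0 := by
  split_ifs with h
  · rw [Set.ncard_eq_one]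
    have hov := ((mem_overlap w).1 h).2
    refine ⟨glue n (toSeq w) (toSeq w), Set.eq_singleton_iff_unique_mem.2
      ⟨⟨glue_mem_words (toSeq_mem_words w), fun j hj => ?_, fun j hj => ?_⟩, ?_⟩⟩
    · rw [Nat.zero_add]
      rcases Nat.lt_or_ge j n with h1 | h1
      · rw [glue_of_lt h1, toSeq_of_lt]
      · rw [glue_of_le h1, toSeq_of_lt w (by omega)]
        exact hov _ _ _ _ (by omega)
    · rw [glue_add, toSeq_of_lt]
    · rintro y ⟨hy, h0, hn'⟩
      refine words_ext hy (glue_mem_words (toSeq_mem_words w)) fun i hi => ?_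
      rcases Nat.lt_or_ge i n with h1 | h1
      · rw [glue_of_lt h1, toSeq_of_lt w (by omega), ← h0 i (by omega), Nat.zero_add]
      · rw [glue_of_le h1, toSeq_of_lt w (by omega), ← hn' (i - n) (by omega),
          Nat.add_sub_cancel' h1]
  · rw [Set.ncard_eq_zero (finite_bordered w n)]
    refine Set.eq_empty_of_forall_notMem fun y ⟨_, h0, h1⟩ => h ?_
    exact h0.sub_mem_overlap hn (by rwa [Nat.zero_add])

theorem ncard_bordered_zero : (bordered w 0).ncard = 1 := by
  rw [Set.ncard_eq_one]
  refine ⟨toSeq w, Set.eq_singleton_iff_unique_mem.2 ⟨⟨?_, ?_, ?_⟩, ?_⟩⟩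
  · rw [Nat.zero_add]
    exact toSeq_mem_words w
  · exact fun j hj => by rw [Nat.zero_add, toSeq_of_lt]
  · exact fun j hj => by rw [Nat.zero_add, toSeq_of_lt]
  · rintro y ⟨hy, h0, -⟩
    rw [Nat.zero_add] at hy
    refine words_ext hy (toSeq_mem_words w) fun i hi => ?_
    rw [toSeq_of_lt w hi, ← h0 i hi, Nat.zero_add]

theorem ncard_bordered_of_le {n : ℕ} (hn : k ≤ n) :
    (bordered w n).ncard = (words q (n - k)).ncard := by
  refine (Set.BijOn.ncard_eq (f := fun z => glue k (toSeq w) (glue (n - k) z (toSeq w)))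
    ⟨?_, ?_, ?_⟩).symm
  · intro z hz
    refine ⟨?_, fun j hj => ?_, fun j hj => ?_⟩
    · have := glue_mem_words (n := k) (y := toSeq w)
        (glue_mem_words (n := n - k) (y := z) (toSeq_mem_words w))
      rwa [show k + (n - k + k) = n + k by omega] at this
    · dsimp only
      rw [Nat.zero_add, glue_of_lt hj, toSeq_of_lt]
    · dsimp only
      rw [show n + j = k + (n - k + j) by omega, glue_add, glue_add, toSeq_of_lt]
  · intro z hz z' hz' h
    refine words_ext hz hz' fun i hi => ?_
    have := congrFun h (k + i)
    simpa only [glue_add, glue_of_lt hi] using this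
  · rintro y ⟨hy, h0, hn'⟩
    refine ⟨truncate (n - k) fun i => y (k + i), truncate_mem_words _ _, ?_⟩
    refine words_ext (n := n + k) ?_ hy fun i hi => ?_
    · have := glue_mem_words (n := k) (y := toSeq w)
        (glue_mem_words (n := n - k) (y := truncate (n - k) fun i => y (k + i))
          (toSeq_mem_words w))
      rwa [show k + (n - k + k) = n + k by omega] at this
    · dsimp only
      rcases Nat.lt_or_ge i k with h1 | h1
      · rw [glue_of_lt h1, toSeq_of_lt w h1, ← h0 i h1, Nat.zero_add]
      · obtain ⟨i, rfl⟩ := Nat.exists_eq_add_of_le h1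
        rw [glue_add]
        rcases Nat.lt_or_ge i (n - k) with h2 | h2
        · rw [glue_of_lt h2, truncate_of_lt h2]
        · rw [glue_of_le h2, toSeq_of_lt w (by omega), ← hn' _ (by omega)]
          congr 1
          omega

/-- Cut a word that begins and ends with `w` at its first occurrence of `w` after the position `s`,
at `m` say. The part before `m` repeats periodically, and moving the origin to `s` makes it
a sequence with period `m` whose first occurrence of `w` after the origin is at `m - s`. The part
from `m` on begins and ends with `w`. Both parts are arbitrary. -/
theorem ncard_bordered_first {n m s : ℕ} (hs : s < m) (hm : m ≤ n) :
    {y ∈ bordered w n | OccursAt w y m ∧ ∀ i, s < i → i < m → ¬ OccursAt w y i}.ncard =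
      {x ∈ periodicContaining w m | OccursAtInt w x (m - s : ℕ) ∧
        ∀ i : ℕ, 0 < i → i < m - s → ¬ OccursAtInt w x i}.ncard * (bordered w (n - m)).ncard := by
  have hm0 : (0 : ℤ) < m := by omega
  rw [← Set.ncard_prod]
  refine (Set.BijOn.ncard_eq (f := fun c => glue m (fun i => c.1 (i - s)) c.2) ⟨?_, ?_, ?_⟩).symm
  · rintro ⟨x, z⟩ ⟨⟨⟨hper, -⟩, hd, hno⟩, hz, hz0, hzn⟩
    rw [isPeriodicPt_shiftMap] at hper
    dsimp only at hper hd hno hz hz0 hzn ⊢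
    have hd' : OccursAtInt w x (-s) := by
      rw [← occursAtInt_add_mul_iff hper (-s) 1]
      convert hd using 1
      omega
    -- The letters number `m, …, m + k - 1` spell `w` in both sequences.
    have hagree : ∀ i < m + k, glue m (fun i => x (i - s)) z i = x (i - s) := by
      intro i hi
      rcases Nat.lt_or_ge i m with h1 | h1
      · rw [glue_of_lt h1]
      · rw [glue_of_le h1, ← Nat.zero_add (i - m), hz0 _ (by omega), ← hd' _ (by omega),
          ← hper (-s + _)]
        congr 1
        omega
    have hocc := fun i hi => occursAt_iff_occursAtInt w hagree (i := i) hi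
    refine ⟨⟨?_, ?_, ?_⟩, ?_, ?_⟩
    · have := glue_mem_words (n := m) (y := fun i => x (i - s)) hz
      rwa [show m + (n - m + k) = n + k by omega] at this
    · rw [hocc 0 (by omega)]
      simpa using hd'
    · refine hzn.congr fun j hj => ?_
      rw [show n + j = m + (n - m + j) by omega, glue_add]
    · rw [hocc m le_rfl]
      convert hd using 1
      omega
    · intro i hi him
      rw [hocc i him.le]
      convert hno (i - s) (by omega) (by omega) using 2
      omega
  · rintro ⟨x, z⟩ ⟨⟨⟨hx, -⟩, -⟩, -⟩ ⟨x', z'⟩ ⟨⟨⟨hx', -⟩, -⟩, -⟩ h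
    rw [isPeriodicPt_shiftMap] at hx hx'
    dsimp only at hx hx' h
    have hz : z = z' := funext fun i => by simpa only [glue_add] using congrFun h (m + i)
    -- The first `m` letters of the glued word are one period of `x`.
    have hmod : ∀ x : ℤ → Fin q, Function.Periodic x m → ∀ i : ℤ,
        x i = x (((i + s) % m).toNat - s) := by
      intro x hx i
      rw [Int.toNat_of_nonneg (Int.emod_nonneg _ hm0.ne'), ← hx.int_mul (-((i + s) / m)) i]
      congr 1
      have := Int.emod_add_mul_ediv (i + s) m
      push_cast
      linarith
    have hx : x = x' := by
      funext i
      rw [hmod x hx, hmod x' hx']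
      have h1 := Int.emod_lt_of_pos (i + s) hm0
      have h2 := Int.emod_nonneg (i + s) hm0.ne'
      have := congrFun h ((i + s) % m).toNat
      rwa [glue_of_lt (by omega), glue_of_lt (by omega)] at this
    rw [hx, hz]
  · rintro y ⟨⟨hy, h0, hn⟩, hym, hno⟩
    obtain ⟨x, hx⟩ : ∃ x : ℤ → Fin q, x = fun i : ℤ => y ((i + s) % m).toNat := ⟨_, rfl⟩
    have hagree : ∀ i < m + k, y i = x (i - s) := by
      intro i hi
      rw [OccursAt.eq_mod (by omega) h0 hym i hi, hx]
      dsimp only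
      rw [sub_add_cancel]
      congr 1
    have hocc := fun i hi => occursAt_iff_occursAtInt w hagree (i := i) hi
    have hd := (hocc m le_rfl).1 hym
    rw [← Nat.cast_sub hs.le] at hd
    refine ⟨(x, fun i => y (m + i)),
      ⟨⟨⟨?_, ⟨_, hd⟩⟩, hd, ?_⟩, ?_, ?_, ?_⟩, ?_⟩
    · rw [isPeriodicPt_shiftMap]
      intro i
      rw [hx]
      dsimp only
      rw [add_right_comm, Int.add_emod_right]
    · intro i hi him h
      refine hno (i + s) (by omega) (by omega) ((hocc _ (by omega)).2 ?_)
      convert h using 1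
      push_cast
      ring
    · exact fun i hi => hy _ (by omega)
    · exact fun j hj => by simpa using hym j hj
    · intro j hj
      rw [← hn j hj]
      dsimp only
      congr 1
      omega
    · funext i
      dsimp only
      rcases Nat.lt_or_ge i m with h1 | h1
      · rw [glue_of_lt h1]
        exact (hagree i (by omega)).symm
      · rw [glue_of_le h1, Nat.add_sub_cancel' h1]

theorem ncard_bordered_eq_sum {n s : ℕ} (hs : s < n) :
    (bordered w n).ncard = ∑ m ∈ Finset.Ioc s n,
      {y ∈ bordered w n | OccursAt w y m ∧ ∀ i, s < i → i < m → ¬ OccursAt w y i}.ncard := by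
  refine ncard_eq_sum_ncard (finite_bordered w n) _ _ ?_ ?_
  · rintro y ⟨-, -, hn⟩
    classical
    have hex : ∃ m, s < m ∧ OccursAt w y m := ⟨n, hs, hn⟩
    obtain ⟨h1, h2⟩ := Nat.find_spec hex
    exact ⟨Nat.find hex, Finset.mem_Ioc.2 ⟨h1, Nat.find_min' hex ⟨hs, hn⟩⟩, h2,
      fun i hi him hi' => Nat.find_min hex him ⟨hi, hi'⟩⟩
  · rintro y - i hi j hj ⟨hi1, hi2⟩ ⟨hj1, hj2⟩
    rw [Finset.mem_Ioc] at hi hj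
    exact le_antisymm (not_lt.1 fun h => hi2 _ hj.1 h hj1) (not_lt.1 fun h => hj2 _ hi.1 h hi1)

/-- The identity between the numbers of periodic points that contain `w` and of words that begin
and end with `w`; in terms of generating functions it reads `t N'(t) = R(t) N(t)`. -/
theorem mul_ncard_bordered (n : ℕ) : n * (bordered w n).ncard =
    ∑ m ∈ Finset.Icc 1 n, (periodicContaining w m).ncard * (bordered w (n - m)).ncard := by
  calc n * (bordered w n).ncard = ∑ s ∈ Finset.range n, (bordered w n).ncard := by simp
    _ = ∑ s ∈ Finset.range n, ∑ m ∈ Finset.Ioc s n, {x ∈ periodicContaining w m |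
          OccursAtInt w x (m - s : ℕ) ∧
          ∀ i : ℕ, 0 < i → i < m - s → ¬ OccursAtInt w x i}.ncard * (bordered w (n - m)).ncard := by
        refine Finset.sum_congr rfl fun s hs => ?_
        rw [ncard_bordered_eq_sum w (Finset.mem_range.1 hs)]
        refine Finset.sum_congr rfl fun m hm => ?_
        rw [Finset.mem_Ioc] at hm
        exact ncard_bordered_first w hm.1 hm.2
    _ = ∑ m ∈ Finset.Icc 1 n, ∑ s ∈ Finset.range m, {x ∈ periodicContaining w m |
          OccursAtInt w x (m - s : ℕ) ∧
          ∀ i : ℕ, 0 < i → i < m - s → ¬ OccursAtInt w x i}.ncard * (bordered w (n - m)).ncard := by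
        refine Finset.sum_comm' fun s m => ?_
        simp only [Finset.mem_range, Finset.mem_Ioc, Finset.mem_Icc]
        omega
    _ = _ := by
        refine Finset.sum_congr rfl fun m hm => ?_
        rw [ncard_periodicContaining_eq_sum w (Finset.mem_Icc.1 hm).1, Finset.sum_mul]

/-- As `N_0 = 1`, the identity `mul_ncard_bordered` determines the numbers of periodic points from
the numbers of words that begin and end with `w`, and conversely. -/
theorem ncard_periodicContaining_eq_iff (u v : Fin k → Fin q) :
    (∀ n, 0 < n → (periodicContaining u n).ncard = (periodicContaining v n).ncard) ↔
      ∀ n, (bordered u n).ncard = (bordered v n).ncard := by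
  constructor
  · intro h n
    induction n using Nat.strong_induction_on with
    | _ n ih =>
      rcases Nat.eq_zero_or_pos n with rfl | hn
      · rw [ncard_bordered_zero, ncard_bordered_zero]
      · refine Nat.eq_of_mul_eq_mul_left hn ?_
        rw [mul_ncard_bordered, mul_ncard_bordered]
        refine Finset.sum_congr rfl fun m hm => ?_
        rw [Finset.mem_Icc] at hm
        rw [h m hm.1, ih (n - m) (by omega)]
  · intro h n
    induction n using Nat.strong_induction_on with
    | _ n ih =>
      intro hn
      obtain ⟨n, rfl⟩ := Nat.exists_eq_succ_of_ne_zero hn.ne'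
      have h1 := mul_ncard_bordered u (n + 1)
      have h2 := mul_ncard_bordered v (n + 1)
      rw [Finset.sum_Icc_succ_top (by omega), Nat.sub_self, ncard_bordered_zero, mul_one] at h1 h2
      have h3 : ∑ m ∈ Finset.Icc 1 n,
            (periodicContaining u m).ncard * (bordered u (n + 1 - m)).ncard =
          ∑ m ∈ Finset.Icc 1 n,
            (periodicContaining v m).ncard * (bordered v (n + 1 - m)).ncard := by
        refine Finset.sum_congr rfl fun m hm => ?_
        rw [Finset.mem_Icc] at hm
        rw [h, ih m (by omega) hm.1]
      rw [h, h2, h3] at h1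
      exact (Nat.add_left_cancel h1).symm

theorem ncard_bordered_eq_iff (u v : Fin k → Fin q) :
    (∀ n, (bordered u n).ncard = (bordered v n).ncard) ↔ overlap u = overlap v := by
  classical
  constructor
  · intro h
    ext i
    by_cases hi : 1 ≤ i ∧ i ≤ k
    · have := h (k - i)
      rw [ncard_bordered_of_lt u (by omega), ncard_bordered_of_lt v (by omega),
        Nat.sub_sub_self hi.2] at this
      split_ifs at this with h1 h2 h2 <;> simp_all
    · rw [mem_overlap, mem_overlap]
      exact ⟨fun h => absurd h.1 hi, fun h => absurd h.1 hi⟩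
  · intro h n
    rcases Nat.lt_or_ge n k with hn | hn
    · rw [ncard_bordered_of_lt u hn, ncard_bordered_of_lt v hn, h]
    · rw [ncard_bordered_of_le u hn, ncard_bordered_of_le v hn]

end Periodic

/-! ### The zeta function -/

/-- The exponential is injective on power series without constant term: `f` is recovered from
`g = exp f` since `g' = g f'`. -/
theorem exp_subst_injective {f g : PowerSeries ℚ} (hf : PowerSeries.constantCoeff f = 0)
    (hg : PowerSeries.constantCoeff g = 0)
    (h : (PowerSeries.exp ℚ).subst f = (PowerSeries.exp ℚ).subst g) : f = g := by
  have hf' := PowerSeries.HasSubst.of_constantCoeff_zero' hf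
  have hg' := PowerSeries.HasSubst.of_constantCoeff_zero' hg
  refine PowerSeries.derivative.ext ?_ (hf.trans hg.symm)
  have hD := congrArg (PowerSeries.derivative ℚ) h
  rw [PowerSeries.derivative_subst hf', PowerSeries.derivative_subst hg',
    PowerSeries.derivative_exp, h] at hD
  refine mul_left_cancel₀ ?_ hD
  have hu := (PowerSeries.isUnit_exp ℚ).map (PowerSeries.substAlgHom hg')
  rw [PowerSeries.coe_substAlgHom] at hu
  exact hu.ne_zero

theorem zeta_eq_iff {q : ℕ} (X X' : Set (ℤ → Fin q)) : zeta X = zeta X' ↔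
    ∀ n, 0 < n → (periodicPoints X n).ncard = (periodicPoints X' n).ncard := by
  have h0 : ∀ X : Set (ℤ → Fin q), PowerSeries.constantCoeff (periodicSeries X) = 0 := by
    intro X
    rw [← PowerSeries.coeff_zero_eq_constantCoeff_apply]
    simp [periodicSeries]
  constructor
  · intro h n hn
    have h1 := congrArg (PowerSeries.coeff n) (exp_subst_injective (h0 X) (h0 X') h)
    simp only [periodicSeries, PowerSeries.coeff_mk, if_neg hn.ne'] at h1
    have hn' : (n : ℚ) ≠ 0 := by exact_mod_cast hn.ne'
    rw [div_left_inj' hn'] at h1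
    exact_mod_cast h1
  · intro h
    have h1 : periodicSeries X = periodicSeries X' := by
      ext n
      simp only [periodicSeries, PowerSeries.coeff_mk]
      split_ifs with hn
      · rfl
      · rw [h n (by omega)]
    rw [zeta, zeta, h1]

theorem zeta_avoidingShift_eq_iff {q k : ℕ} [NeZero q] (u v : Fin k → Fin q) :
    zeta (avoidingShift u) = zeta (avoidingShift v) ↔ overlap u = overlap v := by
  rw [zeta_eq_iff, ← ncard_bordered_eq_iff, ← ncard_periodicContaining_eq_iff]
  refine forall₂_congr fun n hn => ?_
  have h1 := ncard_periodicPoints_add u hn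
  have h2 := ncard_periodicPoints_add v hn
  omega

/-! ### The recurrence and the generating function of the avoiding words -/

/-- The value `φ_w(x)` of the correlation polynomial at a real number. -/
noncomputable def correlation {q k : ℕ} (w : Fin k → Fin q) (x : ℝ) : ℝ :=
  ∑ i ∈ overlap w, x ^ (i - 1)

theorem correlation_natCast {q k : ℕ} (w : Fin k → Fin q) :
    correlation w q = ((correlationPoly w).eval (q : ℤ) : ℤ) := by
  simp [correlation, correlationPoly, Polynomial.eval_finsetSum]

theorem correlation_pos {q k : ℕ} (w : Fin k → Fin q) (hk : 0 < k) {x : ℝ} (hx : 0 < x) :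
    0 < correlation w x :=
  Finset.sum_pos (fun _ _ => by positivity) ⟨k, length_mem_overlap w hk⟩

section Recurrence

variable {q k : ℕ} [NeZero q]

/-- The two counting identities form a linear recurrence of order `k` whose coefficients depend
on the self-overlaps of `w` only. -/
theorem ncard_avoiding_eq_of_overlap_eq (hk : 0 < k) {u v : Fin k → Fin q}
    (h : overlap u = overlap v) (n : ℕ) : (avoiding u n).ncard = (avoiding v n).ncard := by
  suffices H : ∀ m ≤ n, (avoiding u m).ncard = (avoiding v m).ncard ∧
      (firstAtEnd u m).ncard = (firstAtEnd v m).ncard from (H n le_rfl).1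
  induction n with
  | zero =>
    rintro m hm
    obtain rfl : m = 0 := by omega
    exact ⟨by rw [ncard_avoiding_zero u hk, ncard_avoiding_zero v hk],
      by rw [firstAtEnd_of_lt u hk, firstAtEnd_of_lt v hk]⟩
  | succ n ih =>
    intro m hm
    rcases Nat.lt_or_ge n m with hnm | hnm
    swap
    · exact ih m hnm
    obtain rfl : m = n + 1 := by omega
    have he : (firstAtEnd u (n + 1)).ncard = (firstAtEnd v (n + 1)).ncard := by
      rcases Nat.lt_or_ge (n + 1) k with hn | hn
      · rw [firstAtEnd_of_lt u hn, firstAtEnd_of_lt v hn]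
      · -- The term `i = k` of the sum over the self-overlaps of `w` is the only one that is not
        -- known by induction.
        obtain ⟨m, hm⟩ := Nat.exists_eq_add_of_le' hn
        have h1 := ncard_avoiding_eq_sum u m
        have h2 := ncard_avoiding_eq_sum v m
        rw [← Finset.add_sum_erase _ _ (length_mem_overlap _ hk)] at h1 h2
        have h3 : ∑ i ∈ (overlap u).erase k, (firstAtEnd u (m + i)).ncard =
            ∑ i ∈ (overlap v).erase k, (firstAtEnd v (m + i)).ncard := by
          rw [h]
          refine Finset.sum_congr rfl fun i hi => (ih _ ?_).2
          rw [Finset.mem_erase, mem_overlap] at hi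
          omega
        rw [(ih m (by omega)).1] at h1
        rw [hm]
        omega
    have h1 := mul_ncard_avoiding u n
    have h2 := mul_ncard_avoiding v n
    rw [(ih n le_rfl).1] at h1
    exact ⟨by omega, he⟩

variable (w : Fin k → Fin q)

/-- The generating function of the avoiding words, in the variable `1 / x`. -/
theorem tsum_avoiding_mul (hk : 0 < k) {x : ℝ} (hx : 0 < x)
    (hs : Summable fun n : ℕ => ((avoiding w n).ncard : ℝ) / x ^ n) :
    (∑' n : ℕ, ((avoiding w n).ncard : ℝ) / x ^ n) * (1 + (x - q) * correlation w x) =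
      x * correlation w x := by
  set S := ∑' n : ℕ, ((avoiding w n).ncard : ℝ) / x ^ n with hS
  have hS0 : HasSum (fun n : ℕ => ((avoiding w n).ncard : ℝ) / x ^ n) S := hs.hasSum
  have hS1 : HasSum (fun n : ℕ => ((avoiding w (n + 1)).ncard : ℝ) / x ^ (n + 1)) (S - 1) := by
    rw [← hasSum_nat_add_iff' 1] at hS0
    simpa [ncard_avoiding_zero w hk] using hS0
  have hE : HasSum (fun n : ℕ => ((firstAtEnd w n).ncard : ℝ) / x ^ n) (q / x * S - (S - 1)) := by
    have h1 := (hS0.mul_left (q / x)).sub hS1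
    rw [← hasSum_nat_add_iff' 1]
    simp only [Finset.sum_range_one, firstAtEnd_of_lt w hk, Set.ncard_empty, Nat.cast_zero,
      zero_div, sub_zero]
    refine h1.congr_fun fun n => ?_
    have h2 : (q : ℝ) * (avoiding w n).ncard =
        (avoiding w (n + 1)).ncard + (firstAtEnd w (n + 1)).ncard := by
      exact_mod_cast mul_ncard_avoiding w n
    rw [pow_succ]
    field_simp
    linarith
  have hshift : ∀ i ∈ overlap w, HasSum (fun n : ℕ => ((firstAtEnd w (n + i)).ncard : ℝ) / x ^ n)
      (x * (x ^ (i - 1) * (q / x * S - (S - 1)))) := by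
    intro i hi
    obtain ⟨⟨hi1, hik⟩, -⟩ := (mem_overlap w).1 hi
    have h1 := hE
    rw [← hasSum_nat_add_iff' i, Finset.sum_eq_zero, sub_zero] at h1
    · rw [← mul_assoc, ← pow_succ', Nat.sub_add_cancel hi1]
      refine (h1.mul_left (x ^ i)).congr_fun fun n => ?_
      rw [pow_add]
      field_simp
    · intro j hj
      rw [firstAtEnd_of_lt w ((Finset.mem_range.1 hj).trans_le hik)]
      simp
  have hsum := hasSum_sum hshift
  rw [← Finset.mul_sum, ← Finset.sum_mul] at hsum
  have hSeq : S = x * (correlation w x * (q / x * S - (S - 1))) := by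
    refine hS0.unique (hsum.congr_fun fun n => ?_)
    rw [← Finset.sum_div, ncard_avoiding_eq_sum w n]
    push_cast
    rfl
  have h2 : x * (correlation w x * (q / x * S - (S - 1))) =
      correlation w x * (q * S - x * (S - 1)) := by
    field_simp
  rw [h2] at hSeq
  linarith

/-- The words that end at their first occurrence of `w` form a prefix code, so the sum of
`q ^ (-n)` over these words, `n` being the length, is at most one; and the given series is a finite
combination of tails of that sum. -/
theorem summable_avoiding_div (hk : 0 < k) :
    Summable fun n : ℕ => ((avoiding w n).ncard : ℝ) / (q : ℝ) ^ n := by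
  have hq : (0 : ℝ) < q := by exact_mod_cast Nat.pos_of_ne_zero (NeZero.ne q)
  have hpart : ∀ N : ℕ, ∑ n ∈ Finset.range N, ((firstAtEnd w (n + 1)).ncard : ℝ) / (q : ℝ) ^ (n + 1)
      = 1 - ((avoiding w N).ncard : ℝ) / (q : ℝ) ^ N := by
    intro N
    induction N with
    | zero => simp [ncard_avoiding_zero w hk]
    | succ N ih =>
      have h2 : (q : ℝ) * (avoiding w N).ncard =
          (avoiding w (N + 1)).ncard + (firstAtEnd w (N + 1)).ncard := by
        exact_mod_cast mul_ncard_avoiding w N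
      rw [Finset.sum_range_succ, ih, pow_succ]
      field_simp
      linarith
  have hE : Summable fun n : ℕ => ((firstAtEnd w n).ncard : ℝ) / (q : ℝ) ^ n := by
    rw [← summable_nat_add_iff 1]
    refine summable_of_sum_range_le (c := 1) (fun n => by positivity) fun N => ?_
    rw [hpart]
    have : 0 ≤ ((avoiding w N).ncard : ℝ) / (q : ℝ) ^ N := by positivity
    linarith
  have hsum : Summable fun n : ℕ =>
      ∑ i ∈ overlap w, ((firstAtEnd w (n + i)).ncard : ℝ) / (q : ℝ) ^ n := by
    refine summable_sum fun i _ => ?_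
    refine (((summable_nat_add_iff i).2 hE).mul_left ((q : ℝ) ^ i)).congr fun n => ?_
    rw [pow_add]
    field_simp
  refine hsum.congr fun n => ?_
  rw [← Finset.sum_div, ncard_avoiding_eq_sum w n]
  push_cast
  rfl

theorem tsum_avoiding_div (hk : 0 < k) :
    ∑' n : ℕ, ((avoiding w n).ncard : ℝ) / (q : ℝ) ^ n = q * correlation w q := by
  have hq : (0 : ℝ) < q := by exact_mod_cast Nat.pos_of_ne_zero (NeZero.ne q)
  have := tsum_avoiding_mul w hk hq (summable_avoiding_div w hk)
  rwa [sub_self, zero_mul, add_zero, mul_one] at this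

end Recurrence

/-! ### The entropy -/

section Entropy

variable {q k : ℕ}

theorem exists_ne_letter (hq : 2 ≤ q) (a : Fin q) : ∃ c : Fin q, c ≠ a :=
  haveI : Nontrivial (Fin q) := Fin.nontrivial_iff_two_le.2 hq
  exists_ne a

/-- Every word that avoids `w` occurs in a bi-infinite sequence that avoids `w`: extend it to the
right by a letter other than the last one of `w`, and to the left by a letter other than the
first one of `w`. -/
theorem languageWords_avoidingShift (hq : 2 ≤ q) (hk : 0 < k) (w : Fin k → Fin q) (n : ℕ) :
    languageWords (avoidingShift w) n = avoidingWords w n := by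
  ext b
  constructor
  · rintro ⟨x, hx, i, hi⟩ ⟨p, hp, hb⟩
    refine hx ⟨i + p, fun j => ?_⟩
    rw [← hb j, ← hi]
    push_cast
    rw [add_assoc]
  · intro hb
    obtain ⟨c, hc⟩ := exists_ne_letter hq (w ⟨k - 1, by omega⟩)
    obtain ⟨d, hd⟩ := exists_ne_letter hq (w ⟨0, hk⟩)
    refine ⟨fun i => if i < 0 then d else if h : i.toNat < n then b ⟨i.toNat, h⟩ else c, ?_, 0, ?_⟩
    · rintro ⟨i, hi⟩
      rcases lt_or_ge i 0 with h0 | h0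
      · have := hi ⟨0, hk⟩
        simp only [Nat.cast_zero, add_zero, if_pos h0] at this
        exact hd this
      · lift i to ℕ using h0
        have hi' : ∀ j : Fin k, (if h : i + (j : ℕ) < n then b ⟨i + j, h⟩ else c) = w j := by
          intro j
          rw [← hi j]
          dsimp only
          rw [if_neg (by omega)]
          simp only [← Nat.cast_add, Int.toNat_natCast]
        rcases Nat.lt_or_ge n (i + k) with h1 | h1
        · have := hi' ⟨k - 1, by omega⟩
          rw [dif_neg (by dsimp only; omega)] at this
          exact hc this
        · refine hb ⟨i, h1, fun j => ?_⟩
          rw [← hi' j, dif_pos]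
    · intro j
      simp

theorem ncard_avoidingWords_pos (hq : 2 ≤ q) (hk : 0 < k) (w : Fin k → Fin q) (n : ℕ) :
    0 < (avoidingWords w n).ncard := by
  obtain ⟨c, hc⟩ := exists_ne_letter hq (w ⟨0, hk⟩)
  rw [Set.ncard_pos (Set.toFinite _)]
  exact ⟨fun _ => c, fun ⟨i, _, h⟩ => hc (h ⟨0, hk⟩)⟩

theorem tendsto_log_ncard_avoidingWords (hq : 2 ≤ q) (hk : 0 < k) (w : Fin k → Fin q) :
    Tendsto (fun n : ℕ => Real.log (avoidingWords w n).ncard / n) atTop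
      (𝓝 (entropy (avoidingShift w))) := by
  simpa only [languageWords_avoidingShift hq hk] using tendsto_entropy (avoidingShift w)

theorem entropy_nonneg (X : Set (ℤ → Fin q)) : 0 ≤ entropy X :=
  ge_of_tendsto' (tendsto_entropy X) fun n =>
    div_nonneg (Real.log_natCast_nonneg _) (Nat.cast_nonneg n)

/-- By submultiplicativity the entropy is a lower bound for the growth at every length. -/
theorem exp_entropy_pow_le (hq : 2 ≤ q) (hk : 0 < k) (w : Fin k → Fin q) (n : ℕ) :
    Real.exp (entropy (avoidingShift w)) ^ n ≤ (avoidingWords w n).ncard := by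
  have hpos : ∀ n, (0 : ℝ) < (avoidingWords w n).ncard := fun n => by
    exact_mod_cast ncard_avoidingWords_pos hq hk w n
  have hsub : Subadditive fun n : ℕ => Real.log (avoidingWords w n).ncard := by
    intro m n
    rw [← Real.log_mul (hpos m).ne' (hpos n).ne']
    refine Real.log_le_log (hpos _) ?_
    have := ncard_languageWords_add_le (avoidingShift w) m n
    simp only [languageWords_avoidingShift hq hk] at this
    exact_mod_cast this
  have hbdd : BddBelow (Set.range fun n : ℕ => Real.log (avoidingWords w n).ncard / n) := by
    refine ⟨0, ?_⟩
    rintro _ ⟨n, rfl⟩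
    exact div_nonneg (Real.log_natCast_nonneg _) (Nat.cast_nonneg n)
  have hlim : hsub.lim = entropy (avoidingShift w) :=
    tendsto_nhds_unique (hsub.tendsto_lim hbdd) (tendsto_log_ncard_avoidingWords hq hk w)
  rcases Nat.eq_zero_or_pos n with rfl | hn
  · rw [pow_zero]
    exact_mod_cast ncard_avoidingWords_pos hq hk w 0
  · have h1 := hsub.lim_le_div hbdd hn.ne'
    rw [hlim, le_div_iff₀ (by exact_mod_cast hn)] at h1
    rw [← Real.exp_nat_mul, ← Real.exp_log (hpos n), mul_comm]
    exact Real.exp_le_exp.2 h1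

theorem summable_avoidingWords_div (hq : 2 ≤ q) (hk : 0 < k) (w : Fin k → Fin q) {x : ℝ}
    (hx : Real.exp (entropy (avoidingShift w)) < x) :
    Summable fun n : ℕ => ((avoidingWords w n).ncard : ℝ) / x ^ n := by
  have hx0 : 0 < x := (Real.exp_pos _).trans hx
  obtain ⟨c, hc, hcx⟩ := exists_between ((Real.lt_log_iff_exp_lt hx0).2 hx)
  have hcx' : Real.exp c < x := (Real.lt_log_iff_exp_lt hx0).1 hcx
  refine Summable.of_norm_bounded_eventually_nat (g := fun n => (Real.exp c / x) ^ n)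
    (summable_geometric_of_lt_one (by positivity) ((div_lt_one hx0).2 hcx')) ?_
  filter_upwards [(tendsto_log_ncard_avoidingWords hq hk w).eventually_lt_const hc,
    eventually_gt_atTop 0] with n hn hn0
  have hpos : (0 : ℝ) < (avoidingWords w n).ncard := by
    exact_mod_cast ncard_avoidingWords_pos hq hk w n
  rw [Real.norm_of_nonneg (by positivity), div_pow]
  gcongr
  rw [div_lt_iff₀ (by exact_mod_cast hn0)] at hn
  rw [← Real.exp_nat_mul, ← Real.exp_log hpos, mul_comm]
  exact Real.exp_le_exp.2 hn.le

/-- The number `λ = exp h` is a root of `1 + (x - q) φ_w(x)`. For `x > λ` the generating function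
`S(x) = x φ_w(x) / (1 + (x - q) φ_w(x))` is finite and positive, and it is at least
`x / (x - λ)` because there are at least `λ ^ n` words. Letting `x` tend to `λ` gives both
inequalities. -/
theorem entropy_root (hq : 2 ≤ q) (hk : 0 < k) (w : Fin k → Fin q) :
    (q - Real.exp (entropy (avoidingShift w))) *
      correlation w (Real.exp (entropy (avoidingShift w))) = 1 := by
  have : NeZero q := ⟨by omega⟩
  set l := Real.exp (entropy (avoidingShift w)) with hl
  have hl0 : 0 < l := Real.exp_pos _
  have hbound : ∀ x, l < x → 0 ≤ 1 + (x - q) * correlation w x ∧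
      1 + (x - q) * correlation w x ≤ (x - l) * correlation w x := by
    intro x hx
    have hx0 : 0 < x := hl0.trans hx
    have hs := summable_avoidingWords_div hq hk w hx
    have hge : ∑' n : ℕ, (l / x) ^ n ≤ ∑' n : ℕ, ((avoidingWords w n).ncard : ℝ) / x ^ n := by
      refine Summable.tsum_le_tsum (fun n => ?_)
        (summable_geometric_of_lt_one (by positivity) ((div_lt_one hx0).2 hx)) hs
      rw [div_pow]
      gcongr
      exact exp_entropy_pow_le hq hk w n
    rw [tsum_geometric_of_lt_one (by positivity) ((div_lt_one hx0).2 hx)] at hge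
    have hmul : (∑' n : ℕ, ((avoidingWords w n).ncard : ℝ) / x ^ n) *
        (1 + (x - q) * correlation w x) = x * correlation w x := by
      simp only [← ncard_avoiding] at hs ⊢
      exact tsum_avoiding_mul w hk hx0 hs
    set S := ∑' n : ℕ, ((avoidingWords w n).ncard : ℝ) / x ^ n
    have hφ := correlation_pos w hk hx0
    have hxl : 0 < x - l := sub_pos.2 hx
    have hge' : x / (x - l) ≤ S := by
      refine le_of_eq_of_le ?_ hge
      field_simp
    have hS : 0 < S := lt_of_lt_of_le (by positivity) hge'
    have hf : 0 < 1 + (x - q) * correlation w x :=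
      pos_of_mul_pos_right (hmul ▸ mul_pos hx0 hφ) hS.le
    refine ⟨hf.le, ?_⟩
    have h1 := mul_le_mul_of_nonneg_right hge' hf.le
    rw [hmul, div_mul_eq_mul_div, div_le_iff₀ hxl, mul_assoc] at h1
    have := le_of_mul_le_mul_left h1 hx0
    linarith
  have hcont : Continuous (correlation w) := by
    unfold correlation
    fun_prop
  have hlim : Tendsto (fun x => 1 + (x - q) * correlation w x) (𝓝[>] l)
      (𝓝 (1 + (l - q) * correlation w l)) :=
    (Continuous.tendsto (by fun_prop) l).mono_left nhdsWithin_le_nhds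
  have hlim' : Tendsto (fun x => (x - l) * correlation w x) (𝓝[>] l)
      (𝓝 ((l - l) * correlation w l)) :=
    (Continuous.tendsto (by fun_prop) l).mono_left nhdsWithin_le_nhds
  have h1 : 0 ≤ 1 + (l - q) * correlation w l :=
    ge_of_tendsto hlim (eventually_mem_nhdsWithin.mono fun x hx => (hbound x hx).1)
  have h2 : 1 + (l - q) * correlation w l ≤ (l - l) * correlation w l :=
    le_of_tendsto_of_tendsto hlim hlim'
      (eventually_mem_nhdsWithin.mono fun x hx => (hbound x hx).2)
  linarith

end Entropy

/-! ### Digit sums at a root -/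

/-- Let `m` be the largest element in which `A` and `B` differ, say `m ∈ A`. As `m` and `k` both
lie in `A`, `(q - x) (x ^ (k - 1) + x ^ (m - 1)) ≤ 1`. This excludes `x = 1`. If `1 < x`, then
it gives `x ^ (m - 1) (2 - x) < 1`, which says that `x ^ (m - 1)` exceeds the sum of all lower
powers of `x`; hence the sum over `A` exceeds the one over `B`. -/
theorem false_of_sum_pow_eq {q x : ℝ} (hq : 2 ≤ q) (hx : 1 ≤ x) {k m : ℕ} {A B : Finset ℕ}
    (hA : ∀ i ∈ A, 1 ≤ i ∧ i ≤ k) (hB : ∀ i ∈ B, 1 ≤ i) (hkA : k ∈ A)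
    (hA1 : (q - x) * ∑ i ∈ A, x ^ (i - 1) = 1) (hB1 : (q - x) * ∑ i ∈ B, x ^ (i - 1) = 1)
    (hmA : m ∈ A) (hmB : m ∉ B) (hmk : m ≠ k) (hmax : ∀ i, m < i → (i ∈ A ↔ i ∈ B)) : False := by
  have hx0 : 0 < x := by linarith
  have hnonneg : ∀ i : ℕ, 0 ≤ x ^ (i - 1) := fun i => by positivity
  have hApos : 0 < ∑ i ∈ A, x ^ (i - 1) := Finset.sum_pos (fun i _ => by positivity) ⟨k, hkA⟩
  have hqx : 0 < q - x := pos_of_mul_pos_left (by rw [hA1]; exact one_pos) hApos.le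
  have hAB : ∑ i ∈ A, x ^ (i - 1) = ∑ i ∈ B, x ^ (i - 1) :=
    mul_left_cancel₀ hqx.ne' (hA1.trans hB1.symm)
  have hm := hA m hmA
  have htwo : x ^ (k - 1) + x ^ (m - 1) ≤ ∑ i ∈ A, x ^ (i - 1) := by
    rw [← Finset.sum_pair (f := fun i => x ^ (i - 1)) hmk.symm]
    exact Finset.sum_le_sum_of_subset_of_nonneg
      (by intro i hi; rcases Finset.mem_insert.1 hi with rfl | hi
          · exact hkA
          · rwa [Finset.mem_singleton.1 hi]) fun i _ _ => hnonneg i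
  have hpow : x ^ (m - 1) ≤ x ^ (k - 1) := pow_le_pow_right₀ hx (by omega)
  have hsmall : (q - x) * (x ^ (m - 1) + x ^ (m - 1)) ≤ 1 := by
    rw [← hA1]
    exact mul_le_mul_of_nonneg_left (by linarith) hqx.le
  rcases hx.eq_or_lt with rfl | hx1
  · rw [one_pow] at hsmall
    linarith
  · have hgeom : ∑ i ∈ A, x ^ (i - 1) ≤
        ∑ i ∈ A.filter (m < ·), x ^ (i - 1) + ∑ j ∈ Finset.range (m - 1), x ^ j := by
      rw [hAB, ← Finset.sum_filter_add_sum_filter_not B (m < ·)]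
      refine add_le_add (le_of_eq ?_) ?_
      · refine Finset.sum_congr ?_ fun _ _ => rfl
        ext i
        simp only [Finset.mem_filter]
        exact ⟨fun h => ⟨(hmax i h.2).2 h.1, h.2⟩, fun h => ⟨(hmax i h.2).1 h.1, h.2⟩⟩
      · rw [← Finset.sum_image (s := B.filter (¬ m < ·)) (g := fun i => i - 1)
          (f := fun j => x ^ j)]
        · refine Finset.sum_le_sum_of_subset_of_nonneg ?_ fun i _ _ => by positivity
          intro j hj
          obtain ⟨i, hi, rfl⟩ := Finset.mem_image.1 hj
          rw [Finset.mem_filter] at hi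
          have h1 := hB i hi.1
          have h2 : i ≠ m := fun h => hmB (h ▸ hi.1)
          rw [Finset.mem_range]
          omega
        · intro i hi j hj hij
          have h1 := hB i (Finset.mem_filter.1 hi).1
          have h2 := hB j (Finset.mem_filter.1 hj).1
          dsimp only at hij
          omega
    have hlow : ∑ i ∈ A.filter (m < ·), x ^ (i - 1) + x ^ (m - 1) ≤ ∑ i ∈ A, x ^ (i - 1) := by
      rw [← Finset.sum_filter_add_sum_filter_not A (m < ·)]
      refine add_le_add le_rfl ?_
      exact Finset.single_le_sum (f := fun i => x ^ (i - 1)) (fun i _ => hnonneg i)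
        (Finset.mem_filter.2 ⟨hmA, lt_irrefl m⟩)
    have hle : x ^ (m - 1) ≤ ∑ j ∈ Finset.range (m - 1), x ^ j := by linarith
    have hmul := mul_le_mul_of_nonneg_right hle (sub_pos.2 hx1).le
    rw [geom_sum_mul] at hmul
    have h1 : (2 - x) * x ^ (m - 1) ≤ (q - x) * x ^ (m - 1) :=
      mul_le_mul_of_nonneg_right (by linarith) (by positivity)
    linarith

theorem overlap_eq_of_entropy_eq {q k : ℕ} (hq : 2 ≤ q) (hk : 0 < k) (u v : Fin k → Fin q)
    (h : entropy (avoidingShift u) = entropy (avoidingShift v)) : overlap u = overlap v := by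
  have hu := entropy_root hq hk u
  have hv := entropy_root hq hk v
  rw [← h] at hv
  have hx : 1 ≤ Real.exp (entropy (avoidingShift u)) := Real.one_le_exp (entropy_nonneg _)
  have hq' : (2 : ℝ) ≤ q := by exact_mod_cast hq
  have hmem : ∀ w : Fin k → Fin q, ∀ i ∈ overlap w, 1 ≤ i ∧ i ≤ k := fun w i hi =>
    ((mem_overlap w).1 hi).1
  by_contra hne
  have hnonempty : (symmDiff (overlap u) (overlap v)).Nonempty := by
    rw [Finset.nonempty_iff_ne_empty]
    exact fun h => hne (symmDiff_eq_bot.1 h)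
  obtain ⟨m, hm, hmax⟩ := Finset.exists_max_image _ id hnonempty
  have hiff : ∀ i, m < i → (i ∈ overlap u ↔ i ∈ overlap v) := by
    intro i hi
    by_contra hc
    refine absurd (hmax i ?_) (not_le.2 hi)
    rw [Finset.mem_symmDiff]
    tauto
  have hku := length_mem_overlap u hk
  have hkv := length_mem_overlap v hk
  rcases Finset.mem_symmDiff.1 hm with ⟨h1, h2⟩ | ⟨h1, h2⟩
  · exact false_of_sum_pow_eq hq' hx (hmem u) (fun i hi => (hmem v i hi).1) hku hu hv h1 h2
      (fun h => h2 (h ▸ hkv)) hiff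
  · exact false_of_sum_pow_eq hq' hx (hmem v) (fun i hi => (hmem u i hi).1) hkv hv hu h1 h2
      (fun h => h2 (h ▸ hku)) fun i hi => (hiff i hi).symm

/-- The value at `q ≥ 2` of a polynomial with coefficients `0` and `1` determines it. -/
theorem overlap_eq_of_eval_eq {q k : ℕ} (hq : 2 ≤ q) (u v : Fin k → Fin q)
    (h : (correlationPoly u).eval (q : ℤ) = (correlationPoly v).eval (q : ℤ)) :
    overlap u = overlap v := by
  classical
  have hinj : ∀ w : Fin k → Fin q, Set.InjOn (fun i => i - 1) (overlap w : Set ℕ) := by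
    intro w i hi j hj hij
    have h1 := ((mem_overlap w).1 hi).1
    have h2 := ((mem_overlap w).1 hj).1
    dsimp only at hij
    omega
  have himage : ∀ w : Fin k → Fin q, ((correlationPoly w).eval (q : ℤ)) =
      ((∑ j ∈ (overlap w).image fun i => i - 1, q ^ j : ℕ) : ℤ) := by
    intro w
    rw [Finset.sum_image (hinj w)]
    simp [correlationPoly, Polynomial.eval_finsetSum]
  rw [himage, himage, Nat.cast_inj] at h
  have h1 := Finset.geomSum_injective hq h
  have hback : ∀ w : Fin k → Fin q,
      ((overlap w).image fun i => i - 1).image (fun i => i + 1) = overlap w := by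
    intro w
    rw [Finset.image_image]
    refine (Finset.image_congr fun i hi => ?_).trans Finset.image_id
    exact Nat.sub_add_cancel ((mem_overlap w).1 hi).1.1
  rw [← hback u, h1, hback v]

/-! ### The expected hitting time -/

theorem toENNReal_eq_tsum (t : ℕ∞) :
    (t : ℝ≥0∞) = ∑' n : ℕ, if (n : ℕ∞) < t then (1 : ℝ≥0∞) else 0 := by
  induction t using ENat.recTopCoe with
  | top => simp
  | coe m =>
    rw [tsum_eq_sum (s := Finset.range m) fun n hn => by simpa using hn]
    rw [Finset.sum_congr rfl fun n hn => if_pos (by exact_mod_cast Finset.mem_range.1 hn)]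
    simp

theorem lt_hittingTime_iff {q k : ℕ} (w : Fin k → Fin q) (y : ℕ → Fin q) (n : ℕ) :
    (n : ℕ∞) < hittingTime w y ↔ (fun j : Fin n => y j) ∈ avoidingWords w n := by
  rw [← ENat.add_one_le_iff (ENat.natCast_ne_top n), hittingTime, le_sInf_iff]
  constructor
  · rintro h ⟨i, hi, hj⟩
    have := h _ ⟨i, hj, rfl⟩
    norm_cast at this
    omega
  · rintro h _ ⟨i, hj, rfl⟩
    by_contra! hlt
    norm_cast at hlt
    exact h ⟨i, by omega, hj⟩

section Probability

variable {q k : ℕ} {Ω : Type*} [MeasurableSpace Ω] {μ : Measure Ω} {Y : ℕ → Ω → Fin q}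

theorem measure_word_eq [NeZero q] (hY_indep : iIndepFun Y μ)
    (hY_unif : ∀ m, ∀ a : Fin q, μ {ω | Y m ω = a} = (q : ℝ≥0∞)⁻¹) {n : ℕ} (b : Fin n → Fin q) :
    μ ((fun ω (j : Fin n) => Y j ω) ⁻¹' {b}) = ((q : ℝ≥0∞)⁻¹) ^ n := by
  have h := hY_indep.measure_inter_preimage_eq_mul (Finset.range n)
    (sets := fun i => {toSeq b i}) fun i _ => MeasurableSet.singleton _
  have hone : ∀ i, μ (Y i ⁻¹' {toSeq b i}) = (q : ℝ≥0∞)⁻¹ := fun i => hY_unif i (toSeq b i)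
  simp only [hone, Finset.prod_const, Finset.card_range] at h
  rw [← h]
  congr 1
  ext ω
  simp only [Set.mem_preimage, Set.mem_singleton_iff, Set.mem_iInter, Finset.mem_range]
  constructor
  · rintro rfl i hi
    rw [toSeq_of_lt _ hi]
  · intro h
    funext j
    rw [h j j.2, toSeq_of_lt]

theorem measure_words_eq [NeZero q] (hY_meas : ∀ m, Measurable (Y m)) (hY_indep : iIndepFun Y μ)
    (hY_unif : ∀ m, ∀ a : Fin q, μ {ω | Y m ω = a} = (q : ℝ≥0∞)⁻¹) {n : ℕ}
    (S : Set (Fin n → Fin q)) :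
    μ ((fun ω (j : Fin n) => Y j ω) ⁻¹' S) = S.ncard * ((q : ℝ≥0∞)⁻¹) ^ n := by
  classical
  have hmeas : Measurable fun ω (j : Fin n) => Y j ω := measurable_pi_lambda _ fun j => hY_meas j
  have h := sum_measure_preimage_singleton (μ := μ) (Set.toFinite S).toFinset
    fun b _ => hmeas (MeasurableSet.singleton b)
  rw [Set.Finite.coe_toFinset] at h
  rw [← h, Finset.sum_congr rfl fun b _ => measure_word_eq hY_indep hY_unif b,
    Finset.sum_const, nsmul_eq_mul, Set.ncard_eq_toFinset_card S]

/-- The expectation is the sum of the tail probabilities `P(τ > n) = |B_n(w)| / q ^ n`, which is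
the generating function of the avoiding words at the point where its denominator is one. -/
theorem expectedHittingTime_eq [NeZero q] (hk : 0 < k) (w : Fin k → Fin q)
    (hY_meas : ∀ m, Measurable (Y m)) (hY_indep : iIndepFun Y μ)
    (hY_unif : ∀ m, ∀ a : Fin q, μ {ω | Y m ω = a} = (q : ℝ≥0∞)⁻¹) :
    expectedHittingTime w μ Y = ENNReal.ofReal (q * correlation w q) := by
  have hq : (0 : ℝ) < q := by exact_mod_cast Nat.pos_of_ne_zero (NeZero.ne q)
  have hmeas : ∀ n, MeasurableSet ((fun ω (j : Fin n) => Y j ω) ⁻¹' avoidingWords w n) := fun n =>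
    measurable_pi_lambda (fun ω (j : Fin n) => Y j ω) (fun j => hY_meas j)
      (Set.toFinite _).measurableSet
  have hpt : ∀ ω, (hittingTime w (fun m => Y m ω) : ℝ≥0∞) = ∑' n : ℕ,
      ((fun ω (j : Fin n) => Y j ω) ⁻¹' avoidingWords w n).indicator (1 : Ω → ℝ≥0∞) ω := by
    intro ω
    classical
    rw [toENNReal_eq_tsum]
    refine tsum_congr fun n => ?_
    rw [Set.indicator_apply]
    exact if_congr (lt_hittingTime_iff w _ n) rfl rfl
  unfold expectedHittingTime
  rw [lintegral_congr hpt,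
    lintegral_tsum fun n => (measurable_one.indicator (hmeas n)).aemeasurable,
    ← tsum_avoiding_div w hk, ENNReal.ofReal_tsum_of_nonneg (fun n => by positivity)
    (summable_avoiding_div w hk)]
  refine tsum_congr fun n => ?_
  rw [lintegral_indicator_one (hmeas n), measure_words_eq hY_meas hY_indep hY_unif,
    ncard_avoiding, ENNReal.ofReal_div_of_pos (by positivity), ENNReal.ofReal_pow hq.le,
    ENNReal.ofReal_natCast, ENNReal.ofReal_natCast, div_eq_mul_inv, ENNReal.inv_pow]

theorem expectedHittingTime_eq_iff [NeZero q] (hk : 0 < k) (u v : Fin k → Fin q)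
    (hY_meas : ∀ m, Measurable (Y m)) (hY_indep : iIndepFun Y μ)
    (hY_unif : ∀ m, ∀ a : Fin q, μ {ω | Y m ω = a} = (q : ℝ≥0∞)⁻¹) :
    expectedHittingTime u μ Y = expectedHittingTime v μ Y ↔
      (correlationPoly u).eval (q : ℤ) = (correlationPoly v).eval (q : ℤ) := by
  have hq : (0 : ℝ) < q := by exact_mod_cast Nat.pos_of_ne_zero (NeZero.ne q)
  rw [expectedHittingTime_eq hk u hY_meas hY_indep hY_unif,
    expectedHittingTime_eq hk v hY_meas hY_indep hY_unif, ENNReal.ofReal_eq_ofReal_iff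
      (mul_pos hq (correlation_pos u hk hq)).le (mul_pos hq (correlation_pos v hk hq)).le,
    mul_right_inj' hq.ne', correlation_natCast, correlation_natCast, Int.cast_inj]

end Probability

end ForbiddenWord

theorem mainTheorem12 {q k : ℕ} (hq : 2 ≤ q) (u v : Fin k → Fin q)
    {Ω : Type*} [MeasurableSpace Ω] (μ : Measure Ω) [IsProbabilityMeasure μ]
    (Y : ℕ → Ω → Fin q) (hY_meas : ∀ m, Measurable (Y m)) (hY_indep : iIndepFun Y μ)
    (hY_unif : ∀ m, ∀ a : Fin q, μ {ω | Y m ω = a} = (q : ℝ≥0∞)⁻¹) :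
    List.TFAE [
      ForbiddenWord.overlap u = ForbiddenWord.overlap v,
      ForbiddenWord.correlationPoly u = ForbiddenWord.correlationPoly v,
      (ForbiddenWord.correlationPoly u).eval (q : ℤ) =
        (ForbiddenWord.correlationPoly v).eval (q : ℤ),
      ForbiddenWord.expectedHittingTime u μ Y = ForbiddenWord.expectedHittingTime v μ Y,
      ForbiddenWord.zeta (ForbiddenWord.avoidingShift u) =
        ForbiddenWord.zeta (ForbiddenWord.avoidingShift v),
      ∀ n : ℕ, (ForbiddenWord.avoidingWords u n).ncard = (ForbiddenWord.avoidingWords v n).ncard,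
      ∀ᶠ n : ℕ in atTop,
        (ForbiddenWord.avoidingWords u n).ncard = (ForbiddenWord.avoidingWords v n).ncard,
      ForbiddenWord.entropy (ForbiddenWord.avoidingShift u) =
        ForbiddenWord.entropy (ForbiddenWord.avoidingShift v)] := by
  have : NeZero q := ⟨by omega⟩
  rcases Nat.eq_zero_or_pos k with rfl | hk
  · -- There is only one empty word.
    obtain rfl : u = v := Subsingleton.elim u v
    refine List.tfae_of_forall True _ ?_
    simp
  tfae_have 1 → 2 := fun h => by
    rw [ForbiddenWord.correlationPoly, h, ForbiddenWord.correlationPoly]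
  tfae_have 2 → 3 := fun h => by rw [h]
  tfae_have 3 → 1 := ForbiddenWord.overlap_eq_of_eval_eq hq u v
  tfae_have 4 ↔ 3 := ForbiddenWord.expectedHittingTime_eq_iff hk u v hY_meas hY_indep hY_unif
  tfae_have 5 ↔ 1 := ForbiddenWord.zeta_avoidingShift_eq_iff u v
  tfae_have 1 → 6 := fun h n => by
    rw [← ForbiddenWord.ncard_avoiding, ← ForbiddenWord.ncard_avoiding]
    exact ForbiddenWord.ncard_avoiding_eq_of_overlap_eq hk h n
  tfae_have 6 → 7 := fun h => Eventually.of_forall h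
  tfae_have 7 → 8 := fun h => by
    refine tendsto_nhds_unique (ForbiddenWord.tendsto_log_ncard_avoidingWords hq hk u) ?_
    refine (ForbiddenWord.tendsto_log_ncard_avoidingWords hq hk v).congr' ?_
    exact h.mono fun n hn => by simp only [hn]
  tfae_have 8 → 1 := ForbiddenWord.overlap_eq_of_entropy_eq hq hk u v
  tfae_finish
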